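/- **Definitions.** For elements $a,b$ of a bounded distributive lattice write $a\triangleleft b$ if there is $c$ with $a\wedge c=0$ and $b\vee c=1$. A frame $L$ is *compact* if every directed subset with join $1$ contains $1$, and *regular* if $b=\bigvee\{a\mid a\triangleleft b\}$ for all $b\in L$. $\mathbf{KRegFrm}$ is the category of compact regular frames and frame homomorphisms. Locales form the opposite of the category of frames; a locale $X$ is compact Hausdorff if its frame of opens $\mathcal O X$ is compact and its diagonal is a closed sublocale of $X\times X$, and $\mathbf{KHausLoc}$ is the category of compact Hausdorff locales. These notions are also interpreted in the internal logic of the presheaf topos $\hat{\mathcal C}=[\mathcal C^{op},\mathbf{Set}]$ of a small category $\mathcal C$, which gives the categories $\mathbf{KRegFrm}_{\hat{\mathcal C}}$ and $\mathbf{KHausLoc}_{\hat{\mathcal C}}$; an internal frame has in particular an underlying presheaf of bounded distributive lattices $L:\mathcal C^{op}\to\mathbf{DLat}$. For a bounded distributive lattice $N$ let $C(N)$ be the poset, ordered by inclusion, of the ideals $I\subseteq N$ such that for every $a\in I$ there is $b\in I$ with $a\triangleleft b$; a lattice homomorphism $f:N\to M$ induces $C(f):C(N)\to C(M)$, $I\mapsto\{y\mid\exists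 x\in I,\ y\le f(x)\}$. For a functor $A:\mathcal C^{op}\to\mathbf{Pos}$ let $\tilde A:\mathcal C^{op}\to\mathbf{Pos}$ be $$\tilde A(a)=\Big\{(x_f)_f\in\prod_{f:b\to a}A(b)\ \Big|\ A(g)x_f\le x_{fg}\ \text{ for all } c\xrightarrow{g}b\xrightarrow{f}a\Big\},\qquad \big(\tilde A(h)(x)\big)_{f}=x_{hf},$$ with the pointwise order; a natural transformation $\phi:A\to B$ induces $\tilde\phi:\tilde A\to\tilde B$, $\tilde\phi(x)_f=\phi(x_f)$. **Theorem.** For any small category $\mathcal C$ there is an equivalence of categories $$\mathbf{KRegFrm}_{\hat{\mathcal C}}\simeq[\mathcal C^{op},\mathbf{KRegFrm}]$$ which sends an internal compact regular frame $L$ to $C\circ L$, and whose inverse sends $A:\mathcal C^{op}\to\mathbf{KRegFrm}$ to $\tilde A$; that is, on underlying presheaves of posets the two functors of the equivalence are naturally isomorphic to $L\mapsto C\circ L$ and $A\mapsto\tilde A$. Dually, there is an equivalence of categories $$\mathbf{KHausLoc}_{\hat{\mathcal C}}\simeq[\mathcal C,\mathbf{KHausLoc}],$$ given on frames of opens, in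 the same sense, by the same two constructions. -/

import Mathlib

open CategoryTheory Opposite

universe u

namespace PresheafFrame

/-! ### Compact regular frames and compact Hausdorff locales over sets -/

/-- `a ◁ b`: there is `c` with `a ∧ c = 0` and `b ∨ c = 1`. -/
def WellInside {N : Type u} [Lattice N] [BoundedOrder N] (a b : N) : Prop :=
  ∃ c : N, a ⊓ c = ⊥ ∧ b ⊔ c = ⊤

/-- A frame is regular if every element is the join of the elements well inside it. -/
def IsRegularFrame (L : Type u) [Order.Frame L] : Prop :=
  ∀ b : L, b = sSup {a : L | WellInside a b}

/-- The category of compact regular frames and frame homomorphisms. -/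
abbrev KRegFrm : Type (u + 1) :=
  ObjectProperty.FullSubcategory
    (fun L : Frm.{u} => IsCompactElement (⊤ : L) ∧ IsRegularFrame L)

/-- The elements of the frame coproduct `L ⊗ L`, i.e. the opens of the product locale `X × X` when
`L = O(X)`: lower sets of `L × L` that are closed under arbitrary (also empty) joins in each
variable separately. -/
structure IsProductOpen {L : Type u} [Order.Frame L] (W : Set (L × L)) : Prop where
  lower : IsLowerSet W
  sSup_left : ∀ (S : Set L) (y : L), (∀ x ∈ S, (x, y) ∈ W) → (sSup S, y) ∈ W
  sSup_right : ∀ (x : L) (S : Set L), (∀ y ∈ S, (x, y) ∈ W) → (x, sSup S) ∈ W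

/-- The locale of `L` is Hausdorff: its diagonal is a closed sublocale. The right adjoint of the
codiagonal `L ⊗ L → L` sends `a` to `{(x, y) | x ∧ y ≤ a}`, so the diagonal, as a subset of
`L ⊗ L`, consists of the opens of this form; its closure consists of all the opens which contain
the least one of these, `{(x, y) | x ∧ y = 0}`. -/
def IsHausdorffFrame (L : Type u) [Order.Frame L] : Prop :=
  ∀ W : Set (L × L), IsProductOpen W → (∀ x y : L, x ⊓ y = ⊥ → (x, y) ∈ W) →
    ∃ a : L, ∀ x y : L, (x, y) ∈ W ↔ x ⊓ y ≤ a

/-- The category of compact Hausdorff locales, a full subcategory of the category of locales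
(the opposite of the category of frames). -/
abbrev KHausLoc : Type (u + 1) :=
  ObjectProperty.FullSubcategory
    (fun X : Locale.{u} => IsCompactElement (⊤ : X) ∧ IsHausdorffFrame X)

/-! ### Subsets and joins in the internal logic of the presheaf topos

An internal bounded distributive lattice of the presheaf topos is a functor `Cᵒᵖ ⥤ BddDistLat`.
The statements about it that follow are the Kripke-Joyal translations, at a stage `c`, of the
usual statements of the theory of frames. -/

section Internal

variable {C : Type u} [SmallCategory C]

/-- Restriction along `f : b ⟶ c`. -/
abbrev res (L : Cᵒᵖ ⥤ BddDistLat.{u}) {b c : C} (f : b ⟶ c) :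
    BoundedLatticeHom (L.obj (op c)) (L.obj (op b)) :=
  (L.map f.op).hom

lemma res_id (L : Cᵒᵖ ⥤ BddDistLat.{u}) {c : C} (x : L.obj (op c)) : res L (𝟙 c) x = x := by
  simp [res]

lemma res_comp (L : Cᵒᵖ ⥤ BddDistLat.{u}) {b c d : C} (g : d ⟶ b) (f : b ⟶ c)
    (x : L.obj (op c)) : res L (g ≫ f) x = res L g (res L f x) := by
  simp [res]

lemma app_res {L M : Cᵒᵖ ⥤ BddDistLat.{u}} (φ : L ⟶ M) {b c : C} (f : b ⟶ c)
    (x : L.obj (op c)) : φ.app (op b) (res L f x) = res M f (φ.app (op c) x) :=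
  ConcreteCategory.congr_hom (φ.naturality f.op) x

/-- A subset of `L` at stage `c`, i.e. an element at `c` of the power object of `L`: a subfunctor of
`C(-, c) × L`. -/
@[ext]
structure SubsetAt (L : Cᵒᵖ ⥤ BddDistLat.{u}) (c : C) where
  mem : ∀ {b : C}, (b ⟶ c) → Set (L.obj (op b))
  mem_res : ∀ {b d : C} (f : b ⟶ c) (g : d ⟶ b) {x : L.obj (op b)},
    x ∈ mem f → res L g x ∈ mem (g ≫ f)

/-- A binary relation on `L` at stage `c`: a subfunctor of `C(-, c) × L × L`. -/
structure RelAt (L : Cᵒᵖ ⥤ BddDistLat.{u}) (c : C) where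
  mem : ∀ {b : C}, (b ⟶ c) → Set (L.obj (op b) × L.obj (op b))
  mem_res : ∀ {b d : C} (f : b ⟶ c) (g : d ⟶ b) {x y : L.obj (op b)},
    (x, y) ∈ mem f → (res L g x, res L g y) ∈ mem (g ≫ f)

namespace SubsetAt

variable {L M N : Cᵒᵖ ⥤ BddDistLat.{u}} {c : C}

/-- `s` is the join of `S`, internally: `s` is an upper bound of `S`, and it is below every upper
bound of `S` at every later stage. -/
def IsJoin (S : SubsetAt L c) (s : L.obj (op c)) : Prop :=
  (∀ {b : C} (f : b ⟶ c) (y : L.obj (op b)), y ∈ S.mem f → y ≤ res L f s) ∧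
  ∀ {b : C} (f : b ⟶ c) (x : L.obj (op b)),
    (∀ {d : C} (g : d ⟶ b) (y : L.obj (op d)), y ∈ S.mem (g ≫ f) → y ≤ res L g x) →
      res L f s ≤ x

/-- The subset `{a ∧ y | y ∈ S}`. -/
def meetWith (a : L.obj (op c)) (S : SubsetAt L c) : SubsetAt L c where
  mem f := {z | ∃ y ∈ S.mem f, z = res L f a ⊓ y}
  mem_res f g := by
    rintro _ ⟨y, hy, rfl⟩
    exact ⟨res L g y, S.mem_res f g hy, by rw [map_inf, res_comp]⟩

/-- The direct image `{φ y | y ∈ S}`. -/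
def image (φ : L ⟶ M) (S : SubsetAt L c) : SubsetAt M c where
  mem {b} f := {z | ∃ y ∈ S.mem f, φ.app (op b) y = z}
  mem_res f g := by
    rintro _ ⟨y, hy, rfl⟩
    exact ⟨res L g y, S.mem_res f g hy, app_res φ g y⟩

lemma image_id (S : SubsetAt L c) : S.image (𝟙 L) = S := by
  ext b f x
  simp [image]

lemma image_comp (φ : L ⟶ M) (ψ : M ⟶ N) (S : SubsetAt L c) :
    S.image (φ ≫ ψ) = (S.image φ).image ψ := by
  ext b f x
  simp [image]

/-- The subset `{a | a ◁ b}`. -/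
def wellInside (b : L.obj (op c)) : SubsetAt L c where
  mem f := {a | WellInside a (res L f b)}
  mem_res f g := by
    rintro x ⟨y, hy, hy'⟩
    refine ⟨res L g y, ?_, ?_⟩
    · rw [← map_inf, hy, map_bot]
    · rw [res_comp, ← map_sup, hy', map_top]

/-- `S` is inhabited and any two of its elements have an upper bound in it, internally. -/
def IsDirected (S : SubsetAt L c) : Prop :=
  ∀ {b : C} (f : b ⟶ c), (S.mem f).Nonempty ∧ DirectedOn (· ≤ ·) (S.mem f)

end SubsetAt

/-! ### Frames and locales in the presheaf topos -/

/-- An internal bounded distributive lattice is an internal frame if internally every subset has a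
join and binary meets distribute over arbitrary joins. -/
structure IsInternalFrame (L : Cᵒᵖ ⥤ BddDistLat.{u}) : Prop where
  exists_join : ∀ {c : C} (S : SubsetAt L c), ∃ s, S.IsJoin s
  meet_join : ∀ {c : C} (a : L.obj (op c)) (S : SubsetAt L c) (s : L.obj (op c)),
    S.IsJoin s → (S.meetWith a).IsJoin (a ⊓ s)

/-- Internally, every directed subset with join `1` has `1` as an element. -/
def IsInternallyCompact (L : Cᵒᵖ ⥤ BddDistLat.{u}) : Prop :=
  ∀ {c : C} (S : SubsetAt L c), S.IsDirected → S.IsJoin ⊤ → ⊤ ∈ S.mem (𝟙 c)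

/-- Internally, every `b` is the join of `{a | a ◁ b}`. -/
def IsInternallyRegular (L : Cᵒᵖ ⥤ BddDistLat.{u}) : Prop :=
  ∀ {c : C} (b : L.obj (op c)), (SubsetAt.wellInside b).IsJoin b

/-- The internal version of `IsProductOpen` at stage `c`. -/
structure RelAt.IsProductOpen {L : Cᵒᵖ ⥤ BddDistLat.{u}} {c : C} (W : RelAt L c) : Prop where
  lower : ∀ {b : C} (f : b ⟶ c), IsLowerSet (W.mem f)
  join_left : ∀ {b : C} (f : b ⟶ c) (S : SubsetAt L b) (s y : L.obj (op b)), S.IsJoin s →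
    (∀ {d : C} (g : d ⟶ b) (x : L.obj (op d)), x ∈ S.mem g → (x, res L g y) ∈ W.mem (g ≫ f)) →
      (s, y) ∈ W.mem f
  join_right : ∀ {b : C} (f : b ⟶ c) (S : SubsetAt L b) (s x : L.obj (op b)), S.IsJoin s →
    (∀ {d : C} (g : d ⟶ b) (y : L.obj (op d)), y ∈ S.mem g → (res L g x, y) ∈ W.mem (g ≫ f)) →
      (x, s) ∈ W.mem f

/-- The internal version of `IsHausdorffFrame`: the diagonal is a closed sublocale. -/
def IsInternallyHausdorff (L : Cᵒᵖ ⥤ BddDistLat.{u}) : Prop :=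
  ∀ {c : C} (W : RelAt L c), W.IsProductOpen →
    (∀ {b : C} (f : b ⟶ c) (x y : L.obj (op b)), x ⊓ y = ⊥ → (x, y) ∈ W.mem f) →
      ∃ a : L.obj (op c), ∀ {b : C} (f : b ⟶ c) (x y : L.obj (op b)),
        (x, y) ∈ W.mem f ↔ x ⊓ y ≤ res L f a

variable (C) in
/-- Frames in the topos of presheaves on `C`. -/
structure IntFrm where
  lat : Cᵒᵖ ⥤ BddDistLat.{u}
  isFrame : IsInternalFrame lat

/-- Internal frame homomorphisms: internal lattice homomorphisms (preserving `0` and `1`) which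
internally preserve arbitrary joins. -/
@[ext]
structure IntFrm.Hom (L M : IntFrm C) where
  hom : L.lat ⟶ M.lat
  map_join : ∀ {c : C} (S : SubsetAt L.lat c) (s : L.lat.obj (op c)),
    S.IsJoin s → (S.image hom).IsJoin (hom.app (op c) s)

instance : Category (IntFrm C) where
  Hom := IntFrm.Hom
  id L := ⟨𝟙 _, fun S s h => by simpa [SubsetAt.image_id] using h⟩
  comp φ ψ := ⟨φ.hom ≫ ψ.hom, fun S s h => by
    rw [SubsetAt.image_comp]
    simpa using ψ.map_join _ _ (φ.map_join _ _ h)⟩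

variable (C)

/-- The underlying presheaf of lattices of an internal frame. -/
def IntFrm.toLat : IntFrm C ⥤ (Cᵒᵖ ⥤ BddDistLat.{u}) where
  obj L := L.lat
  map φ := φ.hom

/-- The category of compact regular frames in the topos of presheaves on `C`. -/
abbrev IntKRegFrm : Type (u + 1) :=
  ObjectProperty.FullSubcategory
    (fun L : IntFrm C => IsInternallyCompact L.lat ∧ IsInternallyRegular L.lat)

/-- The category of compact Hausdorff locales in the topos of presheaves on `C`, a full subcategory
of the category of internal locales (the opposite of the category of internal frames). -/
abbrev IntKHausLoc : Type (u + 1) :=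
  ObjectProperty.FullSubcategory
    (fun X : (IntFrm C)ᵒᵖ => IsInternallyCompact X.unop.lat ∧ IsInternallyHausdorff X.unop.lat)

end Internal

/-! ### Underlying posets -/

/-- The underlying poset of a bounded distributive lattice. -/
def latToPos : BddDistLat.{u} ⥤ PartOrd.{u} where
  obj N := PartOrd.of N
  map f := PartOrd.ofHom (f.hom : _ →o _)

/-- The underlying poset of a frame. -/
def frmToPos : Frm.{u} ⥤ PartOrd.{u} where
  obj L := PartOrd.of L
  map f := PartOrd.ofHom (f.hom : _ →o _)

/-- The underlying poset of a compact regular frame. -/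
def KRegFrm.toPos : KRegFrm.{u} ⥤ PartOrd.{u} :=
  ObjectProperty.ι _ ⋙ frmToPos

/-- The poset of opens of a compact Hausdorff locale. -/
def KHausLoc.opens : KHausLoc.{u} ⥤ PartOrd.{u}ᵒᵖ where
  obj X := op (PartOrd.of X.obj)
  map f := (frmToPos.map (Quiver.Hom.unop (V := Frm.{u}) f.hom)).op

/-- The presheaf of lattices underlying a compact regular frame of the presheaf topos. -/
def IntKRegFrm.toLat (C : Type u) [SmallCategory C] :
    IntKRegFrm C ⥤ (Cᵒᵖ ⥤ BddDistLat.{u}) :=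
  ObjectProperty.ι _ ⋙ IntFrm.toLat C

/-- The presheaf of lattices of opens of a compact Hausdorff locale of the presheaf topos. -/
def IntKHausLoc.opens (C : Type u) [SmallCategory C] :
    IntKHausLoc C ⥤ (Cᵒᵖ ⥤ BddDistLat.{u})ᵒᵖ :=
  ObjectProperty.ι _ ⋙ (IntFrm.toLat C).op

/-! ### The completion of normal distributive lattices by rounded ideals -/

section Completion

/-- The poset, ordered by inclusion, of the ideals `I` of `N` such that each `a ∈ I` has some
`b ∈ I` with `a ◁ b`. -/
abbrev Completion (N : Type u) [Lattice N] [BoundedOrder N] : Type u :=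
  {I : Order.Ideal N // ∀ a ∈ I, ∃ b ∈ I, WellInside a b}

/-- `I ↦ ↓ f(I)`. -/
def Completion.map {N M : Type u} [Lattice N] [BoundedOrder N] [Lattice M] [BoundedOrder M]
    (f : BoundedLatticeHom N M) : Completion N →o Completion M where
  toFun I := ⟨
    { carrier := {y | ∃ x ∈ I.1, y ≤ f x}
      lower' := fun _ _ h ⟨x, hx, hy⟩ => ⟨x, hx, h.trans hy⟩
      nonempty' := let ⟨x, hx⟩ := I.1.nonempty; ⟨f x, x, hx, le_rfl⟩
      directed' := by
        rintro y ⟨x, hx, hy⟩ y' ⟨x', hx', hy'⟩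
        exact ⟨f (x ⊔ x'), ⟨_, Order.Ideal.sup_mem hx hx', le_rfl⟩,
          hy.trans (OrderHomClass.mono f le_sup_left),
          hy'.trans (OrderHomClass.mono f le_sup_right)⟩ }, by
      rintro y ⟨x, hx, hy⟩
      obtain ⟨b, hb, c, h0, h1⟩ := I.2 x hx
      refine ⟨f b, ⟨b, hb, le_rfl⟩, f c, ?_, ?_⟩
      · refine le_bot_iff.1 ((inf_le_inf_right _ hy).trans ?_)
        rw [← map_inf, h0, map_bot]
      · rw [← map_sup, h1, map_top]⟩
  monotone' := fun _ _ h _ ⟨x, hx, hy⟩ => ⟨x, h hx, hy⟩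

lemma Completion.mem_map {N M : Type u} [Lattice N] [BoundedOrder N] [Lattice M] [BoundedOrder M]
    (f : BoundedLatticeHom N M) (I : Completion N) (y : M) :
    y ∈ (Completion.map f I).1 ↔ ∃ x ∈ I.1, y ≤ f x :=
  Iff.rfl

/-- The completion `C(N)` as a functor to posets. -/
def completion : BddDistLat.{u} ⥤ PartOrd.{u} where
  obj N := PartOrd.of (Completion N)
  map f := PartOrd.ofHom (Completion.map f.hom)
  map_id N := by
    refine PartOrd.ext fun I => Subtype.ext (Order.Ideal.ext (Set.ext fun y => ?_))
    exact ⟨fun ⟨x, hx, hy⟩ => I.1.lower hy hx, fun hy => ⟨y, hy, le_rfl⟩⟩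
  map_comp f g := by
    refine PartOrd.ext fun I => Subtype.ext (Order.Ideal.ext (Set.ext fun y => ?_))
    constructor
    · rintro ⟨x, hx, hy⟩
      exact ⟨f x, ⟨x, hx, le_rfl⟩, hy⟩
    · rintro ⟨z, ⟨x, hx, hz⟩, hy⟩
      exact ⟨x, hx, hy.trans (OrderHomClass.mono g.hom hz)⟩

end Completion

/-! ### The lax-to-ordinary construction -/

section Tilde

variable {C : Type u} [SmallCategory C]

/-- The families `(x_f)` with `x_f ∈ F(b)` for `f : b ⟶ a` and `F(g) x_f ≤ x_{fg}` for all
composable `g : c ⟶ b` and `f : b ⟶ a`, with the pointwise order: the lax limit of `F` over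
`(C/a)ᵒᵖ`. -/
abbrev Tilde (F : Cᵒᵖ ⥤ PartOrd.{u}) (a : C) : Type u :=
  {x : ∀ (b : C), (b ⟶ a) → F.obj (op b) //
    ∀ (b c : C) (g : c ⟶ b) (f : b ⟶ a), F.map g.op (x b f) ≤ x c (g ≫ f)}

/-- `F̃(h)(x)_f = x_{hf}` for `h : a' ⟶ a`. -/
def Tilde.res (F : Cᵒᵖ ⥤ PartOrd.{u}) {a a' : C} (h : a' ⟶ a) : Tilde F a →o Tilde F a' where
  toFun x := ⟨fun b f => x.1 b (f ≫ h), fun b c g f => by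
    simpa using x.2 b c g (f ≫ h)⟩
  monotone' := fun _ _ hxy b f => hxy b (f ≫ h)

/-- `φ̃(x)_f = φ(x_f)`. -/
def Tilde.map {F G : Cᵒᵖ ⥤ PartOrd.{u}} (φ : F ⟶ G) (a : C) : Tilde F a →o Tilde G a where
  toFun x := ⟨fun b f => φ.app (op b) (x.1 b f), fun b c g f => by
    have h := ConcreteCategory.congr_hom (φ.naturality g.op) (x.1 b f)
    exact h.symm.le.trans ((φ.app (op c)).hom.monotone (x.2 b c g f))⟩
  monotone' := fun _ _ hxy b f => (φ.app (op b)).hom.monotone (hxy b f)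

variable (C) in
/-- The functor `F ↦ F̃`. -/
def tilde : (Cᵒᵖ ⥤ PartOrd.{u}) ⥤ (Cᵒᵖ ⥤ PartOrd.{u}) where
  obj F :=
    { obj := fun a => PartOrd.of (Tilde F a.unop)
      map := fun h => PartOrd.ofHom (Tilde.res F h.unop)
      map_id := fun a => by
        refine PartOrd.ext fun x => Subtype.ext (funext fun b => funext fun f => ?_)
        exact congrArg (x.1 b) (Category.comp_id f)
      map_comp := fun h k => by
        refine PartOrd.ext fun x => Subtype.ext (funext fun b => funext fun f => ?_)
        exact congrArg (x.1 b) (Category.assoc f k.unop h.unop).symm }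
  map φ :=
    { app := fun a => PartOrd.ofHom (Tilde.map φ a.unop) }

end Tilde

end PresheafFrame

namespace PresheafFrame

/-! ### The relation `◁` and normal lattices -/

section WellInside

variable {N : Type u} [DistribLattice N] [BoundedOrder N]

lemma le_of_inf_eq_bot_of_sup_eq_top {a b c : N} (h0 : a ⊓ c = ⊥) (h1 : b ⊔ c = ⊤) : a ≤ b := by
  calc a = a ⊓ (b ⊔ c) := by rw [h1, inf_top_eq]
    _ = a ⊓ b := by rw [inf_sup_left, h0, sup_bot_eq]
    _ ≤ b := inf_le_right

lemma WellInside.le {a b : N} (h : WellInside a b) : a ≤ b :=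
  let ⟨_, h0, h1⟩ := h
  le_of_inf_eq_bot_of_sup_eq_top h0 h1

lemma WellInside.mono {a a' b b' : N} (h : WellInside a b) (ha : a' ≤ a) (hb : b ≤ b') :
    WellInside a' b' := by
  obtain ⟨c, h0, h1⟩ := h
  exact ⟨c, le_bot_iff.1 ((inf_le_inf_right c ha).trans h0.le),
    top_le_iff.1 (h1.ge.trans (sup_le_sup_right hb c))⟩

lemma WellInside.bot (b : N) : WellInside ⊥ b := ⟨⊤, by simp, by simp⟩

lemma WellInside.top (a : N) : WellInside a ⊤ := ⟨⊥, by simp, by simp⟩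

lemma WellInside.sup {a a' b b' : N} (h : WellInside a b) (h' : WellInside a' b') :
    WellInside (a ⊔ a') (b ⊔ b') := by
  obtain ⟨c, h0, h1⟩ := h
  obtain ⟨c', h0', h1'⟩ := h'
  refine ⟨c ⊓ c', ?_, ?_⟩
  · rw [inf_sup_right, ← inf_assoc, h0, bot_inf_eq, inf_left_comm, h0', inf_bot_eq, sup_bot_eq]
  · rw [sup_inf_left, sup_right_comm, h1, top_sup_eq, sup_assoc, h1', sup_top_eq, inf_top_eq]

lemma WellInside.inf {a a' b b' : N} (h : WellInside a b) (h' : WellInside a' b') :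
    WellInside (a ⊓ a') (b ⊓ b') := by
  obtain ⟨c, h0, h1⟩ := h
  obtain ⟨c', h0', h1'⟩ := h'
  refine ⟨c ⊔ c', ?_, ?_⟩
  · rw [inf_sup_left, inf_right_comm, h0, bot_inf_eq, inf_assoc, h0', inf_bot_eq, sup_bot_eq]
  · rw [sup_inf_right, ← sup_assoc, h1, top_sup_eq, sup_left_comm, h1', sup_top_eq, inf_top_eq]

lemma WellInside.map {M : Type u} [DistribLattice M] [BoundedOrder M] (f : BoundedLatticeHom N M)
    {a b : N} (h : WellInside a b) : WellInside (f a) (f b) := by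
  obtain ⟨c, h0, h1⟩ := h
  exact ⟨f c, by rw [← map_inf, h0, map_bot], by rw [← map_sup, h1, map_top]⟩

variable (N) in
/-- A bounded distributive lattice is normal if every cover `x ∨ y = 1` can be shrunk to a cover
`x' ∨ y = 1` with `x' ◁ x`. -/
def IsNormalLattice : Prop :=
  ∀ x y : N, x ⊔ y = ⊤ → ∃ x', WellInside x' x ∧ x' ⊔ y = ⊤

lemma IsNormalLattice.exists_between (hN : IsNormalLattice N) {a b : N} (h : WellInside a b) :
    ∃ b', WellInside a b' ∧ WellInside b' b := by
  obtain ⟨c, h0, h1⟩ := h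
  obtain ⟨b', hb, h1'⟩ := hN b c h1
  exact ⟨b', ⟨c, h0, h1'⟩, hb⟩

/-- Build an ideal from a lower set containing `⊥` and closed under binary joins. -/
def idealOfSup (s : Set N) (lower : IsLowerSet s) (bot : ⊥ ∈ s)
    (sup : ∀ a ∈ s, ∀ b ∈ s, a ⊔ b ∈ s) : Order.Ideal N where
  carrier := s
  lower' := lower
  nonempty' := ⟨⊥, bot⟩
  directed' a ha b hb := ⟨a ⊔ b, sup a ha b hb, le_sup_left, le_sup_right⟩

/-- The rounded ideal of the elements well inside `x`. -/
def IsNormalLattice.below (hN : IsNormalLattice N) (x : N) : Completion N :=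
  ⟨idealOfSup {a | WellInside a x} (fun _ _ h ha => ha.mono h le_rfl) (WellInside.bot x)
    fun _ ha _ hb => (ha.sup hb).mono le_rfl (sup_idem x).le,
   fun _ ha => let ⟨b, hab, hb⟩ := hN.exists_between ha; ⟨b, hb, hab⟩⟩

end WellInside

/-! ### The frame of rounded ideals -/

namespace Completion

section Frame

variable {N M : Type u} [DistribLattice N] [BoundedOrder N] [DistribLattice M] [BoundedOrder M]

lemma rounded_sSup (S : Set (Completion N)) :
    ∀ a ∈ sSup (Subtype.val '' S), ∃ b ∈ sSup (Subtype.val '' S), WellInside a b := by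
  have h : sSup (Subtype.val '' S) ≤ idealOfSup
      {a : N | ∃ b ∈ sSup (Subtype.val '' S), WellInside a b}
      (fun _ _ h ⟨b, hb, hab⟩ => ⟨b, hb, hab.mono h le_rfl⟩)
      ⟨⊥, Order.Ideal.bot_mem _, WellInside.bot _⟩
      (fun _ ⟨b, hb, hab⟩ _ ⟨b', hb', hab'⟩ =>
        ⟨b ⊔ b', Order.Ideal.sup_mem hb hb', hab.sup hab'⟩) := by
    refine sSup_le ?_
    rintro _ ⟨I, hI, rfl⟩ a ha
    obtain ⟨b, hb, hab⟩ := I.2 a ha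
    exact ⟨b, (le_sSup (Set.mem_image_of_mem _ hI) : I.1 ≤ _) hb, hab⟩
  exact fun a ha => h ha

instance : SupSet (Completion N) := ⟨fun S => ⟨sSup (Subtype.val '' S), rounded_sSup S⟩⟩

lemma isLUB_sSup (S : Set (Completion N)) : IsLUB S (sSup S) :=
  ⟨fun _ hI => le_sSup (α := Order.Ideal N) (Set.mem_image_of_mem _ hI),
    fun J hJ => sSup_le (α := Order.Ideal N) (by rintro _ ⟨I, hI, rfl⟩; exact hJ hI)⟩

instance : CompleteLattice (Completion N) where
  __ := completeLatticeOfSup (Completion N) isLUB_sSup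
  inf I J := ⟨I.1 ⊓ J.1, fun a ha => by
    obtain ⟨b, hb, hab⟩ := I.2 a ha.1
    obtain ⟨b', hb', hab'⟩ := J.2 a ha.2
    exact ⟨b ⊓ b', ⟨I.1.lower inf_le_left hb, J.1.lower inf_le_right hb'⟩,
      (hab.inf hab').mono (le_inf le_rfl le_rfl) le_rfl⟩⟩
  inf_le_left I J := fun _ h => h.1
  inf_le_right I J := fun _ h => h.2
  le_inf I J K h h' := fun _ ha => ⟨h ha, h' ha⟩
  top := ⟨⊤, fun _ _ => ⟨⊤, trivial, WellInside.top _⟩⟩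
  le_top _ := fun _ _ => trivial

lemma mem_top (a : N) : a ∈ (⊤ : Completion N).1 :=
  trivial

lemma eq_top_of_top_mem {I : Completion N} (h : ⊤ ∈ I.1) : I = ⊤ :=
  top_le_iff.1 fun _ _ => I.1.lower le_top h

/-- To bound a join of rounded ideals it is enough to bound each of them by an ideal, which need
not be rounded. -/
lemma sSup_le_ideal {S : Set (Completion N)} {J : Order.Ideal N} (h : ∀ I ∈ S, I.1 ≤ J) :
    (sSup S).1 ≤ J :=
  sSup_le (α := Order.Ideal N) (by rintro _ ⟨I, hI, rfl⟩; exact h I hI)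

lemma inf_sSup_le (I : Completion N) (S : Set (Completion N)) :
    I ⊓ sSup S ≤ ⨆ J ∈ S, I ⊓ J := by
  set T := ⨆ J ∈ S, I ⊓ J with hT
  have h : (sSup S).1 ≤ idealOfSup {a : N | ∀ x ∈ I.1, x ⊓ a ∈ T.1}
      (fun _ _ h ha x hx => T.1.lower (inf_le_inf_left x h) (ha x hx))
      (fun x _ => by simp)
      (fun a ha b hb x hx => by
        rw [inf_sup_left]
        exact Order.Ideal.sup_mem (ha x hx) (hb x hx)) := by
    refine sSup_le_ideal fun J hJ a ha x hx => ?_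
    have hle : I ⊓ J ≤ T := le_iSup₂_of_le J hJ le_rfl
    exact hle ⟨I.1.lower inf_le_left hx, J.1.lower inf_le_right ha⟩
  intro a ha
  simpa using h ha.2 a ha.1

instance : Order.Frame (Completion N) :=
  Order.Frame.ofMinimalAxioms ⟨inf_sSup_le⟩

lemma isCompactElement_top : IsCompactElement (⊤ : Completion N) := by
  rw [CompleteLattice.isCompactElement_iff_le_of_directed_sSup_le]
  intro S hne hdir h
  obtain ⟨I₀, hI₀⟩ := hne
  have h' : (sSup S).1 ≤ idealOfSup {a : N | ∃ I ∈ S, a ∈ I.1}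
      (fun _ _ h ⟨I, hI, ha⟩ => ⟨I, hI, I.1.lower h ha⟩)
      ⟨I₀, hI₀, Order.Ideal.bot_mem _⟩
      (fun _ ⟨I, hI, ha⟩ _ ⟨J, hJ, hb⟩ =>
        let ⟨K, hK, hIK, hJK⟩ := hdir I hI J hJ
        ⟨K, hK, Order.Ideal.sup_mem (hIK ha) (hJK hb)⟩) :=
    sSup_le_ideal fun I hI a ha => ⟨I, hI, ha⟩
  obtain ⟨I, hI, hI'⟩ := h' (h (mem_top ⊤))
  exact ⟨I, hI, (eq_top_of_top_mem hI').ge⟩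

lemma isRegularFrame (hN : IsNormalLattice N) : IsRegularFrame (Completion N) := by
  intro I
  refine le_antisymm (fun a ha => ?_) (sSup_le fun J hJ => hJ.le)
  obtain ⟨b, hb, hab⟩ := I.2 a ha
  obtain ⟨b', hab', u, h0, h1⟩ := hN.exists_between hab
  have hJ : WellInside (hN.below b') I := by
    refine ⟨hN.below u, ?_, ?_⟩
    · refine le_bot_iff.1 fun x hx => ?_
      have : x ≤ ⊥ := h0 ▸ le_inf (WellInside.le hx.1) (WellInside.le hx.2)
      rw [le_bot_iff.1 this]
      exact Order.Ideal.bot_mem _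
    · obtain ⟨u', hu', h1'⟩ := hN u b (by rw [sup_comm, h1])
      refine eq_top_of_top_mem ?_
      rw [← h1']
      exact Order.Ideal.sup_mem ((le_sup_right : hN.below u ≤ I ⊔ hN.below u) hu')
        ((le_sup_left : I ≤ I ⊔ hN.below u) hb)
  exact (le_sSup hJ : hN.below b' ≤ _) hab'

/-- The frame homomorphism induced by a lattice homomorphism. -/
def frameHom (f : BoundedLatticeHom N M) : FrameHom (Completion N) (Completion M) where
  toFun := Completion.map f
  map_top' := eq_top_of_top_mem ⟨⊤, trivial, by simp⟩
  map_inf' I J := by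
    refine le_antisymm (le_inf ((Completion.map f).monotone inf_le_left)
      ((Completion.map f).monotone inf_le_right)) ?_
    rintro y ⟨⟨x, hx, hy⟩, x', hx', hy'⟩
    exact ⟨x ⊓ x', ⟨I.1.lower inf_le_left hx, J.1.lower inf_le_right hx'⟩, by
      rw [map_inf]; exact le_inf hy hy'⟩
  map_sSup' S := by
    refine le_antisymm ?_ (sSup_le ?_)
    · have h : (sSup S).1 ≤ idealOfSup {x : N | f x ∈ (sSup (Completion.map f '' S)).1}
          (fun _ _ h hx => (sSup (Completion.map f '' S)).1.lower (OrderHomClass.mono f h) hx)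
          (by simp)
          (fun a ha b hb => by
            simp only [Set.mem_ofPred_eq, map_sup]
            exact Order.Ideal.sup_mem ha hb) := by
        refine sSup_le_ideal fun I hI x hx => ?_
        exact (le_sSup (Set.mem_image_of_mem _ hI) : Completion.map f I ≤ _) ⟨x, hx, le_rfl⟩
      rintro y ⟨x, hx, hy⟩
      exact (sSup (Completion.map f '' S)).1.lower hy (h hx)
    · rintro _ ⟨I, hI, rfl⟩
      exact (Completion.map f).monotone (le_sSup hI)

end Frame

end Completion

/-! ### Compact Hausdorff locales are the compact regular ones -/

section Hausdorff

variable {L : Type u} [Order.Frame L]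

lemma exists_mem_sup_eq_top (hL : IsCompactElement (⊤ : L)) {S : Set L} (hne : S.Nonempty)
    (hdir : DirectedOn (· ≤ ·) S) {c : L} (h : sSup S ⊔ c = ⊤) : ∃ y ∈ S, y ⊔ c = ⊤ := by
  rw [CompleteLattice.isCompactElement_iff_le_of_directed_sSup_le] at hL
  obtain ⟨_, ⟨y, hy, rfl⟩, h'⟩ := hL ((· ⊔ c) '' S) (hne.image _) (by
    rintro _ ⟨a, ha, rfl⟩ _ ⟨b, hb, rfl⟩
    obtain ⟨d, hd, had, hbd⟩ := hdir a ha b hb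
    exact ⟨d ⊔ c, ⟨d, hd, rfl⟩, sup_le_sup_right had c, sup_le_sup_right hbd c⟩) (by
    rw [← h]
    obtain ⟨y, hy⟩ := hne
    refine sup_le (sSup_le fun x hx => ?_) ?_
    · exact le_sup_left.trans (le_sSup (Set.mem_image_of_mem (· ⊔ c) hx))
    · exact le_sup_right.trans (le_sSup (Set.mem_image_of_mem (· ⊔ c) hy)))
  exact ⟨y, hy, top_le_iff.1 h'⟩

lemma IsProductOpen.sup_left {W : Set (L × L)} (hW : IsProductOpen W) {x x' y : L}
    (h : (x, y) ∈ W) (h' : (x', y) ∈ W) : (x ⊔ x', y) ∈ W := by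
  rw [← sSup_pair]
  exact hW.sSup_left _ _ (by rintro _ (rfl | rfl) <;> assumption)

lemma IsProductOpen.sup_right {W : Set (L × L)} (hW : IsProductOpen W) {x y y' : L}
    (h : (x, y) ∈ W) (h' : (x, y') ∈ W) : (x, y ⊔ y') ∈ W := by
  rw [← sSup_pair]
  exact hW.sSup_right _ _ (by rintro _ (rfl | rfl) <;> assumption)

lemma IsRegularFrame.mem_of_inf_mem (hL : IsRegularFrame L) {W : Set (L × L)}
    (hW : IsProductOpen W) (h0 : ∀ x y : L, x ⊓ y = ⊥ → (x, y) ∈ W) {x y : L}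
    (h : (x ⊓ y, x ⊓ y) ∈ W) : (x, y) ∈ W := by
  have h1 : (x ⊓ y, y) ∈ W := by
    rw [hL (x ⊓ y)]
    refine hW.sSup_left _ _ ?_
    rintro w ⟨c, hc0, hc1⟩
    have hy : (y ⊓ (x ⊓ y)) ⊔ (y ⊓ c) = y := by rw [← inf_sup_left, hc1, inf_top_eq]
    rw [← hy]
    refine hW.sup_right (hW.lower ⟨?_, inf_le_right⟩ h) (h0 _ _ ?_)
    · exact WellInside.le ⟨c, hc0, hc1⟩
    · rw [inf_left_comm, hc0, inf_bot_eq]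
  rw [hL y]
  refine hW.sSup_right _ _ ?_
  rintro v ⟨c, hc0, hc1⟩
  have hx : (x ⊓ y) ⊔ (x ⊓ c) = x := by rw [← inf_sup_left, hc1, inf_top_eq]
  rw [← hx]
  have hv : v ≤ y := WellInside.le ⟨c, hc0, hc1⟩
  refine hW.sup_left (hW.lower (show (x ⊓ y, v) ≤ (x ⊓ y, y) from ⟨le_rfl, hv⟩) h1) (h0 _ _ ?_)
  · rw [inf_assoc, inf_comm c v, hc0, inf_bot_eq]

lemma IsRegularFrame.isHausdorffFrame (hL : IsRegularFrame L) : IsHausdorffFrame L := by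
  intro W hW h0
  have hdiag : (sSup {x | (x, x) ∈ W}, sSup {x | (x, x) ∈ W}) ∈ W :=
    hW.sSup_left _ _ fun x hx => hW.sSup_right _ _ fun y hy =>
      hL.mem_of_inf_mem hW h0 (hW.lower ⟨inf_le_left, inf_le_left⟩ hx)
  refine ⟨sSup {x | (x, x) ∈ W}, fun x y => ⟨fun h => ?_, fun h => ?_⟩⟩
  · exact le_sSup (hW.lower ⟨inf_le_left, inf_le_right⟩ h)
  · exact hL.mem_of_inf_mem hW h0 (hW.lower ⟨h, h⟩ hdiag)

/-- The elements `v` disjoint from some `z` with `u ∨ z = 1`. -/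
def disjointCover (u : L) : Set L := {v | ∃ z, z ⊓ v = ⊥ ∧ u ⊔ z = ⊤}

/-- The pairs `(x, y)` such that `y` is covered by `disjointCover (b ∨ u)` whenever
`u ∨ x = 1`. -/
def coverRel (b : L) : Set (L × L) :=
  {p | ∀ u, u ⊔ p.1 = ⊤ → p.2 ≤ sSup (disjointCover (b ⊔ u))}

lemma coverRel_sup {b x x' y : L} (h : (x, y) ∈ coverRel b) (h' : (x', y) ∈ coverRel b) :
    (x ⊔ x', y) ∈ coverRel b := by
  intro u hu
  have h1 : y ≤ sSup (disjointCover (b ⊔ (u ⊔ x))) := h' _ (by rw [sup_assoc, hu])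
  refine (le_inf le_rfl h1).trans ?_
  rw [inf_sSup_eq]
  refine iSup₂_le fun v ⟨z, hz, hz'⟩ => ?_
  have h2 : y ≤ sSup (disjointCover (b ⊔ (b ⊔ u ⊔ z))) := h _ (by dsimp only; rw [← hz']; ac_rfl)
  refine (inf_le_inf_right v h2).trans ?_
  rw [sSup_inf_eq]
  refine iSup₂_le fun v' ⟨z', hw, hw'⟩ => le_sSup ⟨z ⊔ z', ?_, ?_⟩
  · rw [inf_sup_right, inf_left_comm, hz, inf_bot_eq, ← inf_assoc, hw, bot_inf_eq, sup_bot_eq]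
  · rw [← hw', ← sup_assoc b, ← sup_assoc b, sup_idem, sup_assoc (b ⊔ u)]

lemma isProductOpen_coverRel (hL : IsCompactElement (⊤ : L)) (b : L) :
    IsProductOpen (coverRel b) where
  lower p q hpq hp u hu :=
    hpq.2.trans (hp u (top_le_iff.1 (hu.ge.trans (sup_le_sup_left hpq.1 u))))
  sSup_right x S h u hu := sSup_le fun y hy => h y hy u hu
  sSup_left S y h := by
    intro u hu
    obtain ⟨t, ht, htu⟩ := exists_mem_sup_eq_top (S := {t | (t, y) ∈ coverRel b}) hL
      ⟨⊥, fun u hu => by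
        rw [sup_bot_eq] at hu
        exact le_top.trans (le_sSup ⟨⊥, by simp, by simp [hu]⟩)⟩
      (fun t ht t' ht' => ⟨t ⊔ t', coverRel_sup ht ht', le_sup_left, le_sup_right⟩)
      (c := u) (top_le_iff.1 (by
        rw [← hu, sup_comm]
        exact sup_le_sup_right (sSup_le_sSup h) u))
    exact ht u (by rw [sup_comm, htu])

lemma IsHausdorffFrame.isRegularFrame (hL : IsCompactElement (⊤ : L)) (h : IsHausdorffFrame L) :
    IsRegularFrame L := by
  intro b
  refine le_antisymm ?_ (sSup_le fun a ha => ha.le)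
  obtain ⟨a, ha⟩ := h _ (isProductOpen_coverRel hL b) (fun x y hxy u hu =>
    le_sSup ⟨x, hxy, by rw [sup_assoc, hu, sup_top_eq]⟩)
  have hb : (b, ⊤) ∈ coverRel b := fun u hu => le_sSup ⟨⊥, by simp, by simpa [sup_comm] using hu⟩
  have hb' : (⊤, b) ∈ coverRel b := (ha _ _).2 (by simpa using (ha _ _).1 hb)
  refine (hb' ⊥ (by simp)).trans (sSup_le_sSup ?_)
  rintro v ⟨z, hz, hz'⟩
  exact ⟨z, by rw [inf_comm, hz], by simpa using hz'⟩

end Hausdorff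

/-! ### Joins in the internal logic -/

section Internal

variable {C : Type u} [SmallCategory C] {L M : Cᵒᵖ ⥤ BddDistLat.{u}} {c : C}

namespace SubsetAt

/-- The restriction of a subset to a later stage. -/
def restrict (S : SubsetAt L c) {b : C} (f : b ⟶ c) : SubsetAt L b where
  mem g := S.mem (g ≫ f)
  mem_res g h x hx := by
    rw [Category.assoc]
    exact S.mem_res _ h hx

lemma IsJoin.restrict {S : SubsetAt L c} {s : L.obj (op c)} (h : S.IsJoin s) {b : C} (f : b ⟶ c) :
    (S.restrict f).IsJoin (res L f s) := by
  refine ⟨fun g y hy => ?_, fun g x hx => ?_⟩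
  · rw [← res_comp]
    exact h.1 (g ≫ f) y hy
  · rw [← res_comp]
    refine h.2 (g ≫ f) x fun k y hy => hx k y ?_
    simpa only [SubsetAt.restrict, Category.assoc] using hy

lemma IsJoin.le {S : SubsetAt L c} {s x : L.obj (op c)} (h : S.IsJoin s)
    (hx : ∀ {b : C} (f : b ⟶ c) (y : L.obj (op b)), y ∈ S.mem f → y ≤ res L f x) : s ≤ x := by
  rw [← res_id L s]
  refine h.2 (𝟙 c) x fun g y hy => hx g y ?_
  rwa [Category.comp_id] at hy

lemma IsJoin.mem_le {S : SubsetAt L c} {s y : L.obj (op c)} (h : S.IsJoin s)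
    (hy : y ∈ S.mem (𝟙 c)) : y ≤ s := by
  rw [← res_id L s]
  exact h.1 (𝟙 c) y hy

/-- The subset `{y ∨ z | y ∈ S}`. -/
def joinWith (z : L.obj (op c)) (S : SubsetAt L c) : SubsetAt L c where
  mem f := {w | ∃ y ∈ S.mem f, w = y ⊔ res L f z}
  mem_res f g := by
    rintro _ ⟨y, hy, rfl⟩
    exact ⟨res L g y, S.mem_res f g hy, by rw [map_sup, res_comp]⟩

/-- The subset `{x, y}`. -/
def pair (x y : L.obj (op c)) : SubsetAt L c where
  mem f := {w | w = res L f x ∨ w = res L f y}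
  mem_res f g := by
    rintro _ (rfl | rfl)
    · exact Or.inl (res_comp L g f x).symm
    · exact Or.inr (res_comp L g f y).symm

lemma isJoin_pair (x y : L.obj (op c)) : (pair x y).IsJoin (x ⊔ y) := by
  refine ⟨?_, fun f w hw => ?_⟩
  · rintro b f _ (rfl | rfl)
    · exact OrderHomClass.mono _ le_sup_left
    · exact OrderHomClass.mono _ le_sup_right
  · rw [map_sup]
    refine sup_le ?_ ?_
    · simpa only [res_id] using hw (𝟙 _) (res L f x) (Or.inl (by rw [Category.id_comp]))
    · simpa only [res_id] using hw (𝟙 _) (res L f y) (Or.inr (by rw [Category.id_comp]))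

lemma isDirected_wellInside (b : L.obj (op c)) : (wellInside b).IsDirected := fun _ =>
  ⟨⟨⊥, WellInside.bot _⟩, fun x hx y hy =>
    ⟨x ⊔ y, (hx.sup hy).mono le_rfl (sup_idem _).le, le_sup_left, le_sup_right⟩⟩

lemma IsDirected.image {S : SubsetAt L c} (h : S.IsDirected) (φ : L ⟶ M) :
    (S.image φ).IsDirected := by
  intro b f
  obtain ⟨⟨y, hy⟩, hd⟩ := h f
  refine ⟨⟨_, y, hy, rfl⟩, ?_⟩
  rintro _ ⟨x, hx, rfl⟩ _ ⟨x', hx', rfl⟩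
  obtain ⟨w, hw, h1, h2⟩ := hd x hx x' hx'
  exact ⟨_, ⟨w, hw, rfl⟩, OrderHomClass.mono (φ.app (op b)).hom h1,
    OrderHomClass.mono (φ.app (op b)).hom h2⟩

end SubsetAt

lemma IsInternallyCompact.exists_mem_sup_eq_top (hL : IsInternallyCompact L) {S : SubsetAt L c}
    (hS : S.IsDirected) {s z : L.obj (op c)} (hs : S.IsJoin s) (h : s ⊔ z = ⊤) :
    ∃ y ∈ S.mem (𝟙 c), y ⊔ z = ⊤ := by
  obtain ⟨y, hy, hyz⟩ := hL (S.joinWith z)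
    (fun {b} f => ⟨let ⟨y, hy⟩ := (hS f).1; ⟨_, y, hy, rfl⟩, by
      rintro _ ⟨x, hx, rfl⟩ _ ⟨x', hx', rfl⟩
      obtain ⟨w, hw, h1, h2⟩ := (hS f).2 x hx x' hx'
      exact ⟨_, ⟨w, hw, rfl⟩, sup_le_sup_right h1 _, sup_le_sup_right h2 _⟩⟩)
    ⟨fun f y _ => by rw [map_top]; exact le_top, fun {b} f x hx => by
      rw [← h, map_sup]
      refine sup_le (hs.2 f x fun g y hy => le_sup_left.trans (hx g _ ⟨y, hy, rfl⟩)) ?_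
      obtain ⟨y, hy⟩ := (hS f).1
      have := hx (𝟙 b) _ ⟨y, by rwa [Category.id_comp], rfl⟩
      rw [res_id, Category.id_comp] at this
      exact le_sup_right.trans this⟩
  exact ⟨y, hy, by rw [hyz, res_id]⟩

lemma isNormalLattice (hc : IsInternallyCompact L) (hr : IsInternallyRegular L) (c : C) :
    IsNormalLattice (L.obj (op c)) := by
  intro x y hxy
  obtain ⟨x', hx', h⟩ := hc.exists_mem_sup_eq_top (SubsetAt.isDirected_wellInside x) (hr x) hxy
  refine ⟨x', ?_, h⟩
  rw [← res_id L x]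
  exact hx'

/-! ### Internal compact Hausdorff locales are the internal compact regular ones -/

lemma IsInternalFrame.inf_join_le (hL : IsInternalFrame L) {S : SubsetAt L c}
    {a s x : L.obj (op c)} (hs : S.IsJoin s)
    (hx : ∀ {b : C} (f : b ⟶ c) (y : L.obj (op b)), y ∈ S.mem f → res L f a ⊓ y ≤ res L f x) :
    a ⊓ s ≤ x := by
  refine (hL.meet_join a S s hs).le ?_
  rintro b f _ ⟨y, hy, rfl⟩
  exact hx f y hy

lemma RelAt.IsProductOpen.sup_left {W : RelAt L c} (hW : W.IsProductOpen) {b : C} {f : b ⟶ c}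
    {x x' y : L.obj (op b)} (h : (x, y) ∈ W.mem f) (h' : (x', y) ∈ W.mem f) :
    (x ⊔ x', y) ∈ W.mem f := by
  refine hW.join_left f _ _ _ (SubsetAt.isJoin_pair x x') ?_
  rintro d g _ (rfl | rfl)
  · exact W.mem_res f g h
  · exact W.mem_res f g h'

lemma RelAt.IsProductOpen.sup_right {W : RelAt L c} (hW : W.IsProductOpen) {b : C} {f : b ⟶ c}
    {x y y' : L.obj (op b)} (h : (x, y) ∈ W.mem f) (h' : (x, y') ∈ W.mem f) :
    (x, y ⊔ y') ∈ W.mem f := by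
  refine hW.join_right f _ _ _ (SubsetAt.isJoin_pair y y') ?_
  rintro d g _ (rfl | rfl)
  · exact W.mem_res f g h
  · exact W.mem_res f g h'

lemma IsInternallyRegular.mem_of_inf_mem (hL : IsInternallyRegular L) {W : RelAt L c}
    (hW : W.IsProductOpen)
    (h0 : ∀ {b : C} (f : b ⟶ c) (x y : L.obj (op b)), x ⊓ y = ⊥ → (x, y) ∈ W.mem f)
    {b : C} {f : b ⟶ c} {x y : L.obj (op b)} (h : (x ⊓ y, x ⊓ y) ∈ W.mem f) :
    (x, y) ∈ W.mem f := by
  have h1 : (x ⊓ y, y) ∈ W.mem f := by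
    refine hW.join_left f _ _ _ (hL (x ⊓ y)) fun {d} g w hw => ?_
    have hwle : w ≤ res L g (x ⊓ y) := WellInside.le hw
    obtain ⟨z, hz0, hz1⟩ := hw
    have hy : (res L g y ⊓ res L g (x ⊓ y)) ⊔ (res L g y ⊓ z) = res L g y := by
      rw [← inf_sup_left, hz1, inf_top_eq]
    rw [← hy]
    refine hW.sup_right (hW.lower _ (show (_, _) ≤ (res L g (x ⊓ y), res L g (x ⊓ y)) from
      ⟨hwle, inf_le_right⟩) (W.mem_res f g h)) (h0 _ _ _ ?_)
    rw [inf_left_comm, hz0, inf_bot_eq]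
  refine hW.join_right f _ _ _ (hL y) fun {d} g v hv => ?_
  have hvle : v ≤ res L g y := WellInside.le hv
  obtain ⟨z, hz0, hz1⟩ := hv
  have hx : (res L g x ⊓ res L g y) ⊔ (res L g x ⊓ z) = res L g x := by
    rw [← inf_sup_left, hz1, inf_top_eq]
  rw [← hx]
  refine hW.sup_left (hW.lower _ (show (_, _) ≤ (res L g (x ⊓ y), res L g y) from
    ⟨(map_inf (res L g) x y).ge, hvle⟩) (W.mem_res f g h1)) (h0 _ _ _ ?_)
  rw [inf_assoc, inf_comm z v, hz0, inf_bot_eq]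

lemma IsInternallyRegular.isInternallyHausdorff (hF : IsInternalFrame L)
    (hL : IsInternallyRegular L) : IsInternallyHausdorff L := by
  intro c W hW h0
  let D : SubsetAt L c := ⟨fun f => {x | (x, x) ∈ W.mem f}, fun f g _ hx => W.mem_res f g hx⟩
  obtain ⟨a, ha⟩ := hF.exists_join D
  have hdiag : (a, a) ∈ W.mem (𝟙 c) := by
    refine hW.join_left (𝟙 c) D a a ha fun {d} g x hx => ?_
    refine hW.join_right _ (D.restrict g) _ x (ha.restrict g) fun {e} k y hy => ?_
    refine hL.mem_of_inf_mem hW h0 (hW.lower _ (show (_, _) ≤ (y, y) from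
      ⟨inf_le_right, inf_le_right⟩) ?_)
    rw [Category.comp_id]
    exact hy
  refine ⟨a, fun {b} f x y => ⟨fun h => ?_, fun h => ?_⟩⟩
  · exact ha.1 f _ (hW.lower f (show (_, _) ≤ (x, y) from ⟨inf_le_left, inf_le_right⟩) h)
  · have := W.mem_res (𝟙 c) f hdiag
    rw [Category.comp_id] at this
    exact hL.mem_of_inf_mem hW h0 (hW.lower f (show (_, _) ≤ (res L f a, res L f a) from
      ⟨h, h⟩) this)

/-- The elements `v` disjoint from some `z` with `u ∨ z = 1`. -/
def SubsetAt.disjointCover (u : L.obj (op c)) : SubsetAt L c where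
  mem f := {v | ∃ z, z ⊓ v = ⊥ ∧ res L f u ⊔ z = ⊤}
  mem_res f g := by
    rintro v ⟨z, hz, hz'⟩
    exact ⟨res L g z, by rw [← map_inf, hz, map_bot],
      by rw [res_comp, ← map_sup, hz', map_top]⟩

/-- The pairs `(x, y)` such that `y` is covered by `disjointCover (b ∨ u)` whenever
`u ∨ x = 1`. -/
def RelAt.coverRel (b : L.obj (op c)) : RelAt L c where
  mem {d} f := {p | ∀ {e : C} (g : e ⟶ d) (u s : L.obj (op e)),
    (SubsetAt.disjointCover (res L (g ≫ f) b ⊔ u)).IsJoin s →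
      u ⊔ res L g p.1 = ⊤ → res L g p.2 ≤ s}
  mem_res f g x y h e k u s hs hu := by
    rw [← res_comp] at hu ⊢
    rw [← Category.assoc] at hs
    exact h (k ≫ g) u s hs hu

lemma RelAt.coverRel_sup (hF : IsInternalFrame L) {b : L.obj (op c)} {d : C} {f : d ⟶ c}
    {x x' y : L.obj (op d)} (h : (x, y) ∈ (coverRel b).mem f)
    (h' : (x', y) ∈ (coverRel b).mem f) : (x ⊔ x', y) ∈ (coverRel b).mem f := by
  intro e g u s hs hu
  dsimp only at hu ⊢
  obtain ⟨s₁, hs₁⟩ := hF.exists_join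
    (SubsetAt.disjointCover (res L (g ≫ f) b ⊔ (u ⊔ res L g x)))
  have h1 : res L g y ≤ s₁ := h' g _ s₁ hs₁ (by dsimp only; rw [sup_assoc, ← map_sup, hu])
  refine (le_inf le_rfl h1).trans (hF.inf_join_le hs₁ ?_)
  rintro e' k v ⟨z, hz, hz'⟩
  obtain ⟨s₂, hs₂⟩ := hF.exists_join (SubsetAt.disjointCover
    (res L ((k ≫ g) ≫ f) b ⊔ (res L k (res L (g ≫ f) b) ⊔ res L k u ⊔ z)))
  have h2 : res L (k ≫ g) y ≤ s₂ := h (k ≫ g) _ s₂ hs₂ (by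
    dsimp only
    rw [← hz', map_sup, map_sup, res_comp L k g x]
    ac_rfl)
  rw [← res_comp, inf_comm]
  refine (inf_le_inf_left v h2).trans (hF.inf_join_le hs₂ ?_)
  rintro e'' l v' ⟨z', hw, hw'⟩
  rw [← res_comp]
  refine hs.1 (l ≫ k) _ ⟨res L l z ⊔ z', ?_, ?_⟩
  · rw [inf_sup_right, ← inf_assoc, ← map_inf, hz, map_bot, bot_inf_eq, inf_left_comm, hw,
      inf_bot_eq, sup_bot_eq]
  · rw [← hw', Category.assoc, res_comp L k (g ≫ f), res_comp L l k]
    simp only [map_sup]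
    rw [← sup_assoc (res L l (res L k (res L (g ≫ f) b))),
      ← sup_assoc (res L l (res L k (res L (g ≫ f) b))), sup_idem, ← sup_assoc]

lemma RelAt.isProductOpen_coverRel (hF : IsInternalFrame L) (hL : IsInternallyCompact L)
    (b : L.obj (op c)) : (coverRel b).IsProductOpen where
  lower f p q hpq hp e g u s hs hu :=
    (OrderHomClass.mono (res L g) hpq.2).trans (hp g u s hs
      (top_le_iff.1 (hu.ge.trans (sup_le_sup_left (OrderHomClass.mono (res L g) hpq.1) u))))
  join_right f S t x ht h e g u s hs hu := by
    refine (ht.restrict g).le fun {e'} k y hy => ?_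
    have := h (k ≫ g) y hy (𝟙 e') (res L k u) (res L k s) (by
      convert hs.restrict k using 1
      ext e'' l v
      simp only [SubsetAt.disjointCover, SubsetAt.restrict, Set.mem_ofPred_eq, map_sup,
        ← res_comp, Category.assoc, Category.id_comp]) (by
      dsimp only at hu ⊢
      rw [← res_comp L, Category.id_comp, res_comp L k g, ← map_sup, hu, map_top])
    simpa only [res_id] using this
  join_left f S t y ht h e g u s hs hu := by
    dsimp only at hu ⊢
    let D : SubsetAt L e := ⟨fun k => {x | (x, res L k (res L g y)) ∈ (coverRel b).mem (k ≫ g ≫ f)},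
      fun k l x hx => by
        have : (res L l x, res L l (res L k (res L g y))) ∈ (coverRel b).mem (l ≫ k ≫ g ≫ f) :=
          (coverRel b).mem_res (k ≫ g ≫ f) l hx
        rw [← res_comp L l k, ← Category.assoc] at this
        exact @this⟩
    obtain ⟨r, hr⟩ := hF.exists_join D
    have hD : D.IsDirected := fun {d} k => ⟨⟨⊥, fun l w r hr hw => by
        dsimp only at hw ⊢
        rw [map_bot, sup_bot_eq] at hw
        exact le_top.trans (hr.mem_le ⟨⊥, by simp, by simp [hw]⟩)⟩,
      fun x hx x' hx' => ⟨x ⊔ x', coverRel_sup hF hx hx', le_sup_left, le_sup_right⟩⟩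
    have htr : res L g t ≤ r := by
      refine (ht.restrict g).le fun {e'} k x hx => hr.1 k x ?_
      have : (x, res L (k ≫ g) y) ∈ (coverRel b).mem ((k ≫ g) ≫ f) := h (k ≫ g) x hx
      rw [res_comp, Category.assoc] at this
      exact @this
    obtain ⟨x, hx, hxu⟩ := hL.exists_mem_sup_eq_top hD hr (z := u) (top_le_iff.1 (by
      rw [← hu, sup_comm]
      exact sup_le_sup_right htr u))
    have := hx (𝟙 e) u s (by simpa only [Category.id_comp] using hs) (by
      dsimp only
      rw [res_id, sup_comm, hxu])
    simpa only [res_id] using this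

lemma IsInternallyHausdorff.isInternallyRegular (hF : IsInternalFrame L)
    (hL : IsInternallyCompact L) (h : IsInternallyHausdorff L) : IsInternallyRegular L := by
  intro c b
  obtain ⟨s, hs⟩ := hF.exists_join (SubsetAt.wellInside b)
  suffices hbs : b = s by
    rw [← hbs] at hs
    exact hs
  refine le_antisymm ?_ (hs.le fun f y hy => WellInside.le hy)
  obtain ⟨a, ha⟩ := h _ (RelAt.isProductOpen_coverRel hF hL b) (fun f x y hxy => by
    intro e g u s hs hu
    exact hs.mem_le ⟨res L g x, by rw [← map_inf, hxy, map_bot],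
      by rw [res_id, sup_assoc, hu, sup_top_eq]⟩)
  have hb : (b, ⊤) ∈ (RelAt.coverRel b).mem (𝟙 c) := by
    intro e g u s hs hu
    refine le_top.trans (hs.mem_le ⟨⊥, by simp, ?_⟩)
    rw [res_id, sup_bot_eq, Category.comp_id, sup_comm, hu]
  have hb' : (⊤, b) ∈ (RelAt.coverRel b).mem (𝟙 c) :=
    (ha _ _ _).2 (by simpa using (ha _ _ _).1 hb)
  have := hb' (𝟙 c) ⊥ s (by
    convert hs using 1
    ext d f v
    simp only [SubsetAt.disjointCover, SubsetAt.wellInside, Set.mem_ofPred_eq, WellInside,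
      Category.comp_id, sup_bot_eq, res_id, inf_comm]) (by simp)
  simpa only [res_id] using this

end Internal

/-! ### The internal frame of lax families -/

section LaxFamily

variable {C : Type u} [SmallCategory C]

/-- The families `(x_f)` with `A(g) x_f ≤ x_{fg}`, for a presheaf of frames `A`. -/
abbrev LaxFamily (A : Cᵒᵖ ⥤ Frm.{u}) (a : C) : Type u :=
  {x : ∀ b : C, (b ⟶ a) → A.obj (op b) //
    ∀ (b c : C) (g : c ⟶ b) (f : b ⟶ a), A.map g.op (x b f) ≤ x c (g ≫ f)}

namespace LaxFamily

variable {A B : Cᵒᵖ ⥤ Frm.{u}} {a : C}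

instance : DistribLattice (LaxFamily A a) where
  sup x y := ⟨fun b f => x.1 b f ⊔ y.1 b f, fun b c g f => by
    rw [map_sup]; exact sup_le_sup (x.2 b c g f) (y.2 b c g f)⟩
  le_sup_left x y := fun b f => le_sup_left
  le_sup_right x y := fun b f => le_sup_right
  sup_le x y z h h' := fun b f => sup_le (h b f) (h' b f)
  inf x y := ⟨fun b f => x.1 b f ⊓ y.1 b f, fun b c g f => by
    rw [map_inf]; exact inf_le_inf (x.2 b c g f) (y.2 b c g f)⟩
  inf_le_left x y := fun b f => inf_le_left
  inf_le_right x y := fun b f => inf_le_right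
  le_inf x y z h h' := fun b f => le_inf (h b f) (h' b f)
  le_sup_inf x y z := fun b f => le_sup_inf

instance : BoundedOrder (LaxFamily A a) where
  top := ⟨fun _ _ => ⊤, fun _ _ _ _ => le_top⟩
  le_top _ := fun _ _ => le_top
  bot := ⟨fun _ _ => ⊥, fun _ _ _ _ => by rw [map_bot]⟩
  bot_le _ := fun _ _ => bot_le

lemma sup_apply (x y : LaxFamily A a) {b : C} (f : b ⟶ a) :
    (x ⊔ y).1 b f = x.1 b f ⊔ y.1 b f := rfl

lemma inf_apply (x y : LaxFamily A a) {b : C} (f : b ⟶ a) :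
    (x ⊓ y).1 b f = x.1 b f ⊓ y.1 b f := rfl

lemma top_apply {b : C} (f : b ⟶ a) : (⊤ : LaxFamily A a).1 b f = ⊤ := rfl

lemma bot_apply {b : C} (f : b ⟶ a) : (⊥ : LaxFamily A a).1 b f = ⊥ := rfl

lemma ext {x y : LaxFamily A a} (h : ∀ {b : C} (f : b ⟶ a), x.1 b f = y.1 b f) : x = y :=
  Subtype.ext (funext fun _ => funext fun f => h f)

/-- The value of a family at the identity. -/
def val (x : LaxFamily A a) : A.obj (op a) := x.1 a (𝟙 a)

/-- The strict family `(A(f) x)_f`. -/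
def const (x : A.obj (op a)) : LaxFamily A a :=
  ⟨fun _ f => A.map f.op x, fun b c g f => by
    dsimp only; rw [op_comp, Functor.map_comp, Frm.comp_apply]⟩

lemma const_apply (x : A.obj (op a)) {b : C} (f : b ⟶ a) : (const x).1 b f = A.map f.op x := rfl

lemma val_const (x : A.obj (op a)) : (const x).val = x := by
  simp [val, const_apply]

lemma map_val_le (x : LaxFamily A a) {b : C} (f : b ⟶ a) : A.map f.op x.val ≤ x.1 b f :=
  (x.2 a b f (𝟙 a)).trans (by rw [Category.comp_id])

lemma const_val_le (x : LaxFamily A a) : const x.val ≤ x := fun _ f => x.map_val_le f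

lemma const_mono {x y : A.obj (op a)} (h : x ≤ y) : const x ≤ const y :=
  fun _ f => OrderHomClass.mono (A.map f.op).hom h

lemma val_mono {x y : LaxFamily A a} (h : x ≤ y) : x.val ≤ y.val := h a (𝟙 a)

lemma const_sup_eq_top {x y : A.obj (op a)} (h : x ⊔ y = ⊤) : const x ⊔ const y = ⊤ :=
  ext fun f => by rw [sup_apply, const_apply, const_apply, ← map_sup, h, map_top, top_apply]

lemma const_inf_eq_bot {x y : A.obj (op a)} (h : x ⊓ y = ⊥) : const x ⊓ const y = ⊥ :=
  ext fun f => by rw [inf_apply, const_apply, const_apply, ← map_inf, h, map_bot, bot_apply]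

lemma eq_top_of_val_eq_top {x : LaxFamily A a} (h : x.val = ⊤) : x = ⊤ := by
  refine top_le_iff.1 (le_trans ?_ x.const_val_le)
  rw [h]
  exact fun b f => by rw [const_apply, map_top]; exact le_top

/-- If `x ∧ z = 0` and `y ∨ z` is `1` at the identity, then `x` lies below the strict family
of `y`. -/
lemma le_const_val {x y z : LaxFamily A a} (h0 : x ⊓ z = ⊥) (h1 : y.val ⊔ z.val = ⊤) :
    x ≤ const y.val :=
  le_of_inf_eq_bot_of_sup_eq_top
    (le_bot_iff.1 ((inf_le_inf_left x z.const_val_le).trans h0.le)) (const_sup_eq_top h1)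

lemma _root_.PresheafFrame.WellInside.const_val {x y : LaxFamily A a} (h : WellInside x y) :
    WellInside x (const y.val) := by
  obtain ⟨z, h0, h1⟩ := h
  refine ⟨const z.val, le_bot_iff.1 ((inf_le_inf_left x z.const_val_le).trans h0.le),
    const_sup_eq_top ?_⟩
  rw [val, val, ← sup_apply, h1, top_apply]

lemma wellInside_const {x y : A.obj (op a)} (h : WellInside x y) :
    WellInside (const x) (const y) :=
  let ⟨z, h0, h1⟩ := h
  ⟨const z, const_inf_eq_bot h0, const_sup_eq_top h1⟩

/-- Reindexing of families. -/
def resHom (A : Cᵒᵖ ⥤ Frm.{u}) {a a' : C} (h : a' ⟶ a) :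
    BoundedLatticeHom (LaxFamily A a) (LaxFamily A a') where
  toFun x := ⟨fun b f => x.1 b (f ≫ h), fun b c g f => by simpa using x.2 b c g (f ≫ h)⟩
  map_sup' _ _ := rfl
  map_inf' _ _ := rfl
  map_top' := rfl
  map_bot' := rfl

/-- A morphism of presheaves of frames acts pointwise on families. -/
def mapHom (φ : A ⟶ B) (a : C) : BoundedLatticeHom (LaxFamily A a) (LaxFamily B a) where
  toFun x := ⟨fun b f => φ.app (op b) (x.1 b f), fun b c g f => by
    have h := ConcreteCategory.congr_hom (φ.naturality g.op) (x.1 b f)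
    exact h.symm.le.trans (OrderHomClass.mono (φ.app (op c)).hom (x.2 b c g f))⟩
  map_sup' x y := ext fun {b} f => map_sup (φ.app (op b)).hom _ _
  map_inf' x y := ext fun {b} f => map_inf (φ.app (op b)).hom _ _
  map_top' := ext fun {b} f => map_top (φ.app (op b)).hom
  map_bot' := ext fun {b} f => map_bot (φ.app (op b)).hom

variable (A) in
/-- The presheaf of lattices of lax families. -/
def presheaf : Cᵒᵖ ⥤ BddDistLat.{u} where
  obj a := BddDistLat.of (LaxFamily A a.unop)
  map h := BddDistLat.ofHom (resHom A h.unop)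
  map_id _ := BddDistLat.ext fun x => ext fun {b} f => congrArg (x.1 b) (Category.comp_id f)
  map_comp h k := BddDistLat.ext fun x => ext fun {b} f =>
    congrArg (x.1 b) (Category.assoc f k.unop h.unop).symm

/-- The action of `presheaf` on morphisms. -/
def presheafMap (φ : A ⟶ B) : presheaf A ⟶ presheaf B where
  app a := BddDistLat.ofHom (mapHom φ a.unop)

/-- The join of a subset is computed pointwise at the identities. -/
def join (S : SubsetAt (presheaf A) a) : LaxFamily A a :=
  ⟨fun b f => sSup (val '' (show Set (LaxFamily A b) from S.mem f)), fun b c g f => by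
    rw [map_sSup]
    refine sSup_le ?_
    rintro _ ⟨_, ⟨y, hy, rfl⟩, rfl⟩
    refine (y.map_val_le g).trans (le_sSup ⟨resHom A g y, S.mem_res f g hy, ?_⟩)
    exact congrArg (y.1 c) (Category.id_comp g)⟩

lemma isJoin_join (S : SubsetAt (presheaf A) a) : S.IsJoin (join S) := by
  refine ⟨fun {b} f y hy => ?_, fun {b} f x hx => ?_⟩
  · intro d g
    refine le_sSup ⟨resHom A g y, S.mem_res f g hy, ?_⟩
    exact congrArg (y.1 d) (Category.id_comp g)
  · intro d g
    refine sSup_le ?_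
    rintro _ ⟨y, hy, rfl⟩
    refine (hx g y hy d (𝟙 d)).trans ?_
    exact (congrArg (x.1 d) (Category.id_comp g)).le

lemma IsJoin.eq {S : SubsetAt (presheaf A) a} {s : LaxFamily A a} (hs : S.IsJoin s) :
    s = join S :=
  le_antisymm (SubsetAt.IsJoin.le hs (isJoin_join S).1) (SubsetAt.IsJoin.le (isJoin_join S) hs.1)

variable (A) in
lemma isInternalFrame_presheaf : IsInternalFrame (presheaf A) where
  exists_join S := ⟨join S, isJoin_join S⟩
  meet_join {c} x S s hs := by
    rw [IsJoin.eq hs]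
    suffices h : (show LaxFamily A c from x) ⊓ join S = join (S.meetWith x) by
      exact h ▸ isJoin_join (S.meetWith x)
    refine le_antisymm (fun b f => ?_) ?_
    · rw [inf_apply]
      change _ ⊓ sSup _ ≤ sSup _
      rw [inf_sSup_eq]
      refine iSup₂_le ?_
      rintro _ ⟨y, hy, rfl⟩
      refine le_sSup ⟨resHom A f x ⊓ y, ⟨y, hy, rfl⟩, ?_⟩
      exact congrArg (· ⊓ y.val) (congrArg (x.1 b) (Category.id_comp f))
    · refine SubsetAt.IsJoin.le (isJoin_join _) ?_
      rintro b f _ ⟨y, hy, rfl⟩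
      exact inf_le_inf_left (resHom A f x) ((isJoin_join S).1 f y hy)

lemma isInternallyCompact_presheaf (hA : ∀ a, IsCompactElement (⊤ : A.obj a)) :
    IsInternallyCompact (presheaf A) := by
  intro c S hS h
  have hc := (CompleteLattice.isCompactElement_iff_le_of_directed_sSup_le _ _).1 (hA (op c))
    (val '' (show Set (LaxFamily A c) from S.mem (𝟙 c))) ((hS _).1.image _) (by
      rintro _ ⟨x, hx, rfl⟩ _ ⟨y, hy, rfl⟩
      obtain ⟨z, hz, hxz, hyz⟩ := (hS (𝟙 c)).2 x hx y hy
      exact ⟨_, ⟨z, hz, rfl⟩, val_mono hxz, val_mono hyz⟩)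
    (congrArg val (IsJoin.eq h)).le
  obtain ⟨_, ⟨y, hy, rfl⟩, hy'⟩ := hc
  exact eq_top_of_val_eq_top (top_le_iff.1 hy') ▸ hy

lemma isInternallyRegular_presheaf (hA : ∀ a, IsRegularFrame (A.obj a)) :
    IsInternallyRegular (presheaf A) := by
  intro c x
  suffices h : (show LaxFamily A c from x) = join (SubsetAt.wellInside x) by
    exact (congrArg (SubsetAt.IsJoin _) h).mpr (isJoin_join _)
  refine le_antisymm (fun b f => ?_) ?_
  · rw [hA (op b) (x.1 b f)]
    refine sSup_le fun y hy => le_sSup ⟨const y, ?_, val_const y⟩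
    refine (wellInside_const hy).mono le_rfl ?_
    have : x.1 b f = val (resHom A f x) := (congrArg (x.1 b) (Category.id_comp f)).symm
    rw [this]
    exact const_val_le _
  · exact SubsetAt.IsJoin.le (isJoin_join _) fun f y hy => WellInside.le hy

lemma isJoin_image (φ : A ⟶ B) (S : SubsetAt (presheaf A) a) {s : LaxFamily A a}
    (hs : S.IsJoin s) : (S.image (presheafMap φ)).IsJoin (mapHom φ a s) := by
  rw [IsJoin.eq hs]
  suffices h : mapHom φ a (join S) = join (S.image (presheafMap φ)) by
    exact h ▸ isJoin_join _
  refine ext fun {b} f => ?_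
  refine (map_sSup (φ.app (op b)).hom _).trans (congrArg sSup (Set.ext fun z => ?_))
  constructor
  · rintro ⟨_, ⟨y, hy, rfl⟩, rfl⟩
    exact ⟨mapHom φ b y, ⟨y, hy, rfl⟩, rfl⟩
  · rintro ⟨_, ⟨y, hy, rfl⟩, rfl⟩
    exact ⟨_, ⟨y, hy, rfl⟩, rfl⟩

end LaxFamily

end LaxFamily

section Equivalence

variable {C : Type u} [SmallCategory C]

/-! ### Lattice isomorphisms of internal frames -/

lemma SubsetAt.IsJoin.image_iso {L M : Cᵒᵖ ⥤ BddDistLat.{u}} (i : L ≅ M) {c : C}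
    {S : SubsetAt L c} {s : L.obj (op c)} (hs : S.IsJoin s) :
    (S.image i.hom).IsJoin (i.hom.app (op c) s) := by
  have h1 : ∀ {b : C} (x : M.obj (op b)), i.hom.app (op b) (i.inv.app (op b) x) = x :=
    fun {b} x => ConcreteCategory.congr_hom (i.inv_hom_id_app (op b)) x
  refine ⟨?_, fun {b} f x hx => ?_⟩
  · rintro b f _ ⟨y, hy, rfl⟩
    rw [← app_res]
    exact OrderHomClass.mono (i.hom.app (op b)).hom (hs.1 f y hy)
  · rw [← app_res, ← h1 x]
    refine OrderHomClass.mono (i.hom.app (op b)).hom (hs.2 f _ fun {d} g y hy => ?_)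
    have h2 : i.inv.app (op d) (i.hom.app (op d) y) = y :=
      ConcreteCategory.congr_hom (i.hom_inv_id_app (op d)) y
    rw [← app_res, ← h2]
    exact OrderHomClass.mono (i.inv.app (op d)).hom (hx g _ ⟨y, hy, rfl⟩)

/-- An isomorphism of the underlying presheaves of lattices is an isomorphism of internal
frames. -/
def IntFrm.isoOfLatIso {L M : IntFrm C} (i : L.lat ≅ M.lat) : L ≅ M where
  hom := ⟨i.hom, fun _ _ h => h.image_iso i⟩
  inv := ⟨i.inv, fun _ _ h => h.image_iso i.symm⟩
  hom_inv_id := IntFrm.Hom.ext i.hom_inv_id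
  inv_hom_id := IntFrm.Hom.ext i.inv_hom_id

/-! ### The two functors -/

/-- The presheaf of frames `C ∘ L`. -/
def completionPresheaf (L : Cᵒᵖ ⥤ BddDistLat.{u}) : Cᵒᵖ ⥤ Frm.{u} where
  obj a := Frm.of (Completion (L.obj a))
  map f := Frm.ofHom (Completion.frameHom (L.map f).hom)
  map_id a := Frm.ext fun I =>
    ConcreteCategory.congr_hom ((L ⋙ completion).map_id a) I
  map_comp f g := Frm.ext fun I =>
    ConcreteCategory.congr_hom ((L ⋙ completion).map_comp f g) I

variable (C) in
/-- The functor `L ↦ C ∘ L` on internal compact regular frames. -/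
def completionFunctor : IntKRegFrm C ⥤ (Cᵒᵖ ⥤ KRegFrm.{u}) where
  obj L := ObjectProperty.lift _ (completionPresheaf L.obj.lat) fun a =>
    ⟨Completion.isCompactElement_top, Completion.isRegularFrame
      (isNormalLattice L.property.1 L.property.2 a.unop)⟩
  map {L M} φ :=
    { app := fun a => ObjectProperty.homMk (Frm.ofHom (Completion.frameHom (φ.hom.hom.app a).hom))
      naturality := fun a b f => ObjectProperty.hom_ext _ (Frm.ext fun I =>
        ConcreteCategory.congr_hom (((Functor.whiskeringRight Cᵒᵖ _ _).obj completion).map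
          φ.hom.hom |>.naturality f) I) }
  map_id L := by
    ext a : 2
    exact ObjectProperty.hom_ext _ (Frm.ext fun I =>
      ConcreteCategory.congr_hom (completion.map_id (L.obj.lat.obj a)) I)
  map_comp φ ψ := by
    ext a : 2
    exact ObjectProperty.hom_ext _ (Frm.ext fun I =>
      ConcreteCategory.congr_hom
        (completion.map_comp (φ.hom.hom.app a) (ψ.hom.hom.app a)) I)

variable (C) in
/-- The functor `A ↦ Ã` on presheaves of compact regular frames. -/
def laxFamilyFunctor : (Cᵒᵖ ⥤ KRegFrm.{u}) ⥤ IntKRegFrm C where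
  obj A := ⟨⟨LaxFamily.presheaf (A ⋙ ObjectProperty.ι _), LaxFamily.isInternalFrame_presheaf _⟩,
    LaxFamily.isInternallyCompact_presheaf fun a => (A.obj a).property.1,
    LaxFamily.isInternallyRegular_presheaf fun a => (A.obj a).property.2⟩
  map φ := ObjectProperty.homMk
    ⟨LaxFamily.presheafMap (Functor.whiskerRight φ _), LaxFamily.isJoin_image _⟩

/-! ### Internal compact regular frames are recovered from their rounded ideals -/

section Unit

variable {L : Cᵒᵖ ⥤ BddDistLat.{u}} {c : C}

/-- A lax family of rounded ideals as an internal subset of the lattice. -/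
def familySubset (I : LaxFamily (completionPresheaf L) c) : SubsetAt L c where
  mem {b} f := {x | x ∈ (show Completion (L.obj (op b)) from I.1 b f).1}
  mem_res {b d} f g x hx := I.2 b d g f ⟨x, hx, le_rfl⟩

lemma isDirected_familySubset (I : LaxFamily (completionPresheaf L) c) :
    (familySubset I).IsDirected := fun {b} f =>
  ⟨(show Completion (L.obj (op b)) from I.1 b f).1.nonempty,
    (show Completion (L.obj (op b)) from I.1 b f).1.directed⟩

/-- The family of the rounded ideals of elements well inside the restrictions of `x`. -/
def belowFamily (hc : IsInternallyCompact L) (hr : IsInternallyRegular L) (x : L.obj (op c)) :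
    LaxFamily (completionPresheaf L) c :=
  ⟨fun b f => (isNormalLattice hc hr b).below (res L f x), fun b d g f => by
    rintro y ⟨a, ha, hy⟩
    exact (WellInside.map (res L g) ha).mono hy (res_comp L g f x).ge⟩

lemma belowFamily_of_isJoin (hc : IsInternallyCompact L) (hr : IsInternallyRegular L)
    (I : LaxFamily (completionPresheaf L) c) {s : L.obj (op c)} (hs : (familySubset I).IsJoin s) :
    belowFamily hc hr s = I := by
  refine LaxFamily.ext fun {b} f => Subtype.ext (Order.Ideal.ext (Set.ext fun y => ?_))
  constructor
  · rintro ⟨z, h0, h1⟩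
    obtain ⟨x, hx, hxz⟩ := hc.exists_mem_sup_eq_top
      (S := (familySubset I).restrict f) (fun g => isDirected_familySubset I (g ≫ f))
      (hs.restrict f) h1
    change x ∈ (familySubset I).mem (𝟙 b ≫ f) at hx
    rw [Category.id_comp] at hx
    exact (show Completion (L.obj (op b)) from I.1 b f).1.lower
      (le_of_inf_eq_bot_of_sup_eq_top h0 hxz) hx
  · intro hy
    obtain ⟨x, hx, hyx⟩ := (show Completion (L.obj (op b)) from I.1 b f).2 y hy
    exact hyx.mono le_rfl (hs.1 f x hx)

/-- An internal compact regular frame is isomorphic to its frame of rounded ideals. -/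
noncomputable def belowIso (hF : IsInternalFrame L) (hc : IsInternallyCompact L)
    (hr : IsInternallyRegular L) (c : C) :
    L.obj (op c) ≃o LaxFamily (completionPresheaf L) c where
  toFun := belowFamily hc hr
  invFun I := (hF.exists_join (familySubset I)).choose
  left_inv x := by
    have h := (hF.exists_join (familySubset (belowFamily hc hr x))).choose_spec
    exact le_antisymm (h.le (hr x).1) ((hr x).le h.1)
  right_inv I := belowFamily_of_isJoin hc hr I (hF.exists_join (familySubset I)).choose_spec
  map_rel_iff' {x y} := by
    constructor
    · intro h
      exact (hr x).le fun {b} f a ha => WellInside.le (h b f ha)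
    · intro h b f a ha
      exact WellInside.mono ha le_rfl (OrderHomClass.mono (res L f) h)

/-- The presheaf version of `belowIso`. -/
noncomputable def belowPresheafIso (hF : IsInternalFrame L) (hc : IsInternallyCompact L)
    (hr : IsInternallyRegular L) : L ≅ LaxFamily.presheaf (completionPresheaf L) :=
  NatIso.ofComponents (fun a => BddDistLat.Iso.mk (belowIso hF hc hr a.unop)) fun {a b} f => by
    refine BddDistLat.ext fun x => LaxFamily.ext fun {d} g => ?_
    exact congrArg (isNormalLattice hc hr d).below (res_comp L g f.unop x).symm

end Unit

variable (C) in
/-- The unit of the equivalence. -/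
noncomputable def unitIso : 𝟭 (IntKRegFrm C) ≅ completionFunctor C ⋙ laxFamilyFunctor C :=
  NatIso.ofComponents
    (fun L => ObjectProperty.isoMk _ (IntFrm.isoOfLatIso
      (belowPresheafIso L.obj.isFrame L.property.1 L.property.2))) fun {L M} φ => by
    refine ObjectProperty.hom_ext _ (IntFrm.Hom.ext (NatTrans.ext (funext fun a =>
      BddDistLat.ext fun x => LaxFamily.ext fun {b} f =>
        Subtype.ext (Order.Ideal.ext (Set.ext fun y => ?_)))))
    have hφ : res M.obj.lat f (φ.hom.hom.app a x) = φ.hom.hom.app (op b) (res L.obj.lat f x) :=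
      (app_res φ.hom.hom f x).symm
    change WellInside y (res M.obj.lat f (φ.hom.hom.app a x)) ↔
      ∃ z, WellInside z (res L.obj.lat f x) ∧ y ≤ φ.hom.hom.app (op b) z
    rw [hφ]
    generalize res L.obj.lat f x = w
    constructor
    · rintro ⟨z, h0, h1⟩
      obtain ⟨_, ⟨v, hv, rfl⟩, h⟩ := IsInternallyCompact.exists_mem_sup_eq_top M.property.1
        (SubsetAt.IsDirected.image (SubsetAt.isDirected_wellInside w) φ.hom.hom)
        (φ.hom.map_join _ _ (L.property.2 w)) h1
      refine ⟨v, ?_, le_of_inf_eq_bot_of_sup_eq_top h0 h⟩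
      rw [← res_id L.obj.lat w]
      exact hv
    · rintro ⟨z, hz, hy⟩
      exact (hz.map (φ.hom.hom.app (op b)).hom).mono hy le_rfl

/-! ### Presheaves of compact regular frames are recovered from their lax families -/

section Counit

variable {A B : Cᵒᵖ ⥤ Frm.{u}} {a : C}

/-- The join of the values at the identity of the families in a rounded ideal. -/
def idealVal (I : Completion (LaxFamily A a)) : A.obj (op a) :=
  sSup (LaxFamily.val '' (I.1 : Set (LaxFamily A a)))

/-- The evaluation `C(Ã(a)) ≅ A(a)`. -/
noncomputable def idealValIso (hc : ∀ a, IsCompactElement (⊤ : A.obj a))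
    (hr : ∀ a, IsRegularFrame (A.obj a)) (a : C) :
    Completion (LaxFamily A a) ≃o A.obj (op a) :=
  have hN : IsNormalLattice (LaxFamily A a) :=
    isNormalLattice (LaxFamily.isInternallyCompact_presheaf hc)
      (LaxFamily.isInternallyRegular_presheaf hr) a
  have mono : Monotone (idealVal : Completion (LaxFamily A a) → A.obj (op a)) :=
    fun _ _ h => sSup_le_sSup (Set.image_mono h)
  have left (I : Completion (LaxFamily A a)) : hN.below (LaxFamily.const (idealVal I)) = I := by
    refine Subtype.ext (Order.Ideal.ext (Set.ext fun y => ?_))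
    constructor
    · rintro ⟨z, h0, h1⟩
      have h1' : idealVal I ⊔ z.val = ⊤ := by
        have := congrArg LaxFamily.val h1
        rwa [LaxFamily.val, LaxFamily.sup_apply, LaxFamily.val, LaxFamily.top_apply,
          ← LaxFamily.val, LaxFamily.val_const] at this
      obtain ⟨_, ⟨x, hx, rfl⟩, hxz⟩ := exists_mem_sup_eq_top (hc (op a))
        (I.1.nonempty.image LaxFamily.val) (by
          rintro _ ⟨x, hx, rfl⟩ _ ⟨y, hy, rfl⟩
          exact ⟨_, ⟨x ⊔ y, Order.Ideal.sup_mem hx hy, rfl⟩, LaxFamily.val_mono le_sup_left,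
            LaxFamily.val_mono le_sup_right⟩) h1'
      exact I.1.lower ((LaxFamily.le_const_val h0 hxz).trans x.const_val_le) hx
    · intro hy
      obtain ⟨x, hx, hyx⟩ := I.2 y hy
      exact hyx.const_val.mono le_rfl (LaxFamily.const_mono (le_sSup ⟨x, hx, rfl⟩))
  have right (x : A.obj (op a)) : idealVal (hN.below (LaxFamily.const x)) = x := by
    refine le_antisymm (sSup_le ?_) ?_
    · rintro _ ⟨y, hy, rfl⟩
      exact (LaxFamily.val_mono (WellInside.le hy)).trans (LaxFamily.val_const x).le
    · conv_lhs => rw [hr (op a) x]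
      exact sSup_le fun y hy => le_sSup
        ⟨LaxFamily.const y, LaxFamily.wellInside_const hy, LaxFamily.val_const y⟩
  { toFun := idealVal
    invFun := fun x => hN.below (LaxFamily.const x)
    left_inv := left
    right_inv := right
    map_rel_iff' := by
      intro I J
      refine ⟨fun h => ?_, fun h => mono h⟩
      rw [← left I, ← left J]
      exact fun y hy => WellInside.mono hy le_rfl (LaxFamily.const_mono h) }

lemma idealVal_map_res {b : C} (f : b ⟶ a) (I : Completion (LaxFamily A a)) :
    idealVal (Completion.map (LaxFamily.resHom A f) I) = A.map f.op (idealVal I) := by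
  rw [idealVal, idealVal, map_sSup]
  refine le_antisymm (sSup_le ?_) (sSup_le ?_)
  · rintro _ ⟨y, ⟨x, hx, hy⟩, rfl⟩
    obtain ⟨x', hx', hxx'⟩ := I.2 x hx
    refine le_trans ?_ (le_sSup ⟨_, ⟨x', hx', rfl⟩, rfl⟩)
    refine (LaxFamily.val_mono hy).trans ?_
    refine le_trans ?_ (hxx'.const_val.le b f)
    exact (congrArg (x.1 b) (Category.id_comp f)).le
  · rintro _ ⟨_, ⟨x, hx, rfl⟩, rfl⟩
    refine (x.map_val_le f).trans (le_sSup ⟨LaxFamily.resHom A f x, ⟨x, hx, le_rfl⟩, ?_⟩)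
    exact congrArg (x.1 b) (Category.id_comp f)

lemma idealVal_map (φ : A ⟶ B) (I : Completion (LaxFamily A a)) :
    idealVal (Completion.map (LaxFamily.mapHom φ a) I) = φ.app (op a) (idealVal I) := by
  rw [idealVal, idealVal, map_sSup]
  refine le_antisymm (sSup_le ?_) (sSup_le ?_)
  · rintro _ ⟨y, ⟨x, hx, hy⟩, rfl⟩
    exact (LaxFamily.val_mono hy).trans (le_sSup ⟨_, ⟨x, hx, rfl⟩, rfl⟩)
  · rintro _ ⟨_, ⟨x, hx, rfl⟩, rfl⟩
    exact le_sSup ⟨LaxFamily.mapHom φ a x, ⟨x, hx, le_rfl⟩, rfl⟩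

end Counit

variable (C) in
/-- The counit of the equivalence. -/
noncomputable def counitIso :
    laxFamilyFunctor C ⋙ completionFunctor C ≅ 𝟭 (Cᵒᵖ ⥤ KRegFrm.{u}) :=
  NatIso.ofComponents
    (fun A => NatIso.ofComponents
      (fun a => ObjectProperty.isoMk _ (Frm.Iso.mk (idealValIso (A := A ⋙ ObjectProperty.ι _)
        (fun a => (A.obj a).property.1) (fun a => (A.obj a).property.2) a.unop)))
      fun f => ObjectProperty.hom_ext _ (Frm.ext fun I =>
        idealVal_map_res (A := A ⋙ ObjectProperty.ι _) f.unop I))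
    fun φ => NatTrans.ext (funext fun _ => ObjectProperty.hom_ext _ (Frm.ext fun I =>
      idealVal_map (Functor.whiskerRight φ (ObjectProperty.ι _)) I))

variable (C) in
/-- Internal compact regular frames are presheaves of compact regular frames. -/
noncomputable def kRegFrmEquivalence : IntKRegFrm C ≌ (Cᵒᵖ ⥤ KRegFrm.{u}) :=
  .mk (completionFunctor C) (laxFamilyFunctor C) (unitIso C) (counitIso C)

end Equivalence

/-! ### Compact Hausdorff locales -/

/-- Compact Hausdorff locales are dual to compact regular frames. -/
def kRegFrmOpEquivalence : KRegFrm.{u}ᵒᵖ ≌ KHausLoc.{u} where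
  functor :=
    { obj := fun L => ⟨op L.unop.obj, L.unop.property.1,
        IsRegularFrame.isHausdorffFrame L.unop.property.2⟩
      map := fun f => ObjectProperty.homMk (Quiver.Hom.op (V := Frm.{u}) f.unop.hom) }
  inverse :=
    { obj := fun X => op ⟨X.obj.unop, X.property.1,
        IsHausdorffFrame.isRegularFrame X.property.1 X.property.2⟩
      map := fun f => (ObjectProperty.homMk (Quiver.Hom.unop (V := Frm.{u}) f.hom)).op }
  unitIso := Iso.refl _
  counitIso := Iso.refl _

/-- Internal compact Hausdorff locales are dual to internal compact regular frames. -/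
def intKHausLocEquivalence (C : Type u) [SmallCategory C] :
    IntKHausLoc C ≌ (IntKRegFrm C)ᵒᵖ where
  functor :=
    { obj := fun X => op ⟨X.obj.unop, X.property.1,
        IsInternallyHausdorff.isInternallyRegular X.obj.unop.isFrame X.property.1 X.property.2⟩
      map := fun f => (ObjectProperty.homMk f.hom.unop).op }
  inverse :=
    { obj := fun L => ⟨op L.unop.obj, L.unop.property.1,
        IsInternallyRegular.isInternallyHausdorff L.unop.obj.isFrame L.unop.property.2⟩
      map := fun f => ObjectProperty.homMk f.unop.hom.op }
  unitIso := Iso.refl _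
  counitIso := Iso.refl _

/-- Internal compact Hausdorff locales are functors to compact Hausdorff locales. -/
noncomputable def kHausLocEquivalence (C : Type u) [SmallCategory C] :
    IntKHausLoc C ≌ (C ⥤ KHausLoc.{u}) :=
  (intKHausLocEquivalence C).trans ((kRegFrmEquivalence C).op.trans
    ((Functor.leftOpRightOpEquiv C KRegFrm.{u}).trans (kRegFrmOpEquivalence.congrRight)))

end PresheafFrame

theorem mainTheorem1 (C : Type u) [SmallCategory C] :
    (∃ e : PresheafFrame.IntKRegFrm C ≌ (Cᵒᵖ ⥤ PresheafFrame.KRegFrm.{u}),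
      Nonempty (e.functor ⋙ (Functor.whiskeringRight Cᵒᵖ _ _).obj PresheafFrame.KRegFrm.toPos ≅
        PresheafFrame.IntKRegFrm.toLat C ⋙
          (Functor.whiskeringRight Cᵒᵖ _ _).obj PresheafFrame.completion) ∧
      Nonempty (e.inverse ⋙ PresheafFrame.IntKRegFrm.toLat C ⋙
          (Functor.whiskeringRight Cᵒᵖ _ _).obj PresheafFrame.latToPos ≅
        (Functor.whiskeringRight Cᵒᵖ _ _).obj PresheafFrame.KRegFrm.toPos ⋙
          PresheafFrame.tilde C)) ∧
    (∃ e : PresheafFrame.IntKHausLoc C ≌ (C ⥤ PresheafFrame.KHausLoc.{u}),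
      Nonempty (e.functor ⋙ (Functor.whiskeringRight C _ _).obj PresheafFrame.KHausLoc.opens ≅
        PresheafFrame.IntKHausLoc.opens C ⋙
          ((Functor.whiskeringRight Cᵒᵖ _ _).obj PresheafFrame.completion).op ⋙
          (Functor.leftOpRightOpEquiv C PartOrd.{u}).functor) ∧
      Nonempty (e.inverse ⋙ PresheafFrame.IntKHausLoc.opens C ⋙
          ((Functor.whiskeringRight Cᵒᵖ _ _).obj PresheafFrame.latToPos).op ≅
        (Functor.whiskeringRight C _ _).obj PresheafFrame.KHausLoc.opens ⋙
          (Functor.leftOpRightOpEquiv C PartOrd.{u}).inverse ⋙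
          (PresheafFrame.tilde C).op)) := by
  refine ⟨⟨PresheafFrame.kRegFrmEquivalence C, ⟨Iso.refl _⟩, ⟨Iso.refl _⟩⟩,
    ⟨PresheafFrame.kHausLocEquivalence C, ⟨Iso.refl _⟩, ⟨Iso.refl _⟩⟩⟩
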